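/- Let $N\ge 0$ and let $P=P_n y^n+P_{n-1}y^{n-1}+\dots+P_0$ be a polynomial in $y$ of degree $n$ whose coefficients $P_i\in\mathbb C[x_1,\dots,x_N]$ are polynomials, irreducible over the field $\mathbb C(x_1,\dots,x_N)$. Let $J$ be the discriminant of $P$ with respect to $y$, and let $\Sigma=\{x\in\mathbb C^N : P_n(x)J(x)=0\}$. For a point $b\in\mathbb C^N\setminus\Sigma$, the monodromy group of the equation $P=0$ (with base point $b$) is the group of permutations of the set of analytic germs $f$ at $b$ with $P(x,f(x))=0$ near $b$ that are induced by analytic continuation along loops based at $b$ in $\mathbb C^N\setminus\Sigma$ (up to isomorphism it does not depend on $b$). Let $x_0\in\mathbb C^N\setminus\Sigma$, and let $y_{x_0}$ be an analytic germ at $x_0$ satisfying $P(x,y_{x_0}(x))=0$ near $x_0$. (1) If the monodromy group of the equation is solvable, then the germ $y_{x_0}$ is representable by radicals, i.e. it is obtained from germs of complex constants and of coordinate functions (in any number of variables) by finitely many compositions, arithmetic operations (with division $f/g$ only by germs $g$ that do not vanish at the point considered), and extractions of $m$-th roots, $m=2,3,\dots$ (passing from a germ $f$ to an analytic germ $g$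 with $g^m=f$). (2) For every $k$, if the monodromy group of the equation is $k$-solvable, then the germ $y_{x_0}$ is representable by $k$-radicals, i.e. it is obtained in the same way, where in addition it is allowed to pass from germs $f_1,\dots,f_m$ with $1\le m\le k$ to an analytic germ $z$ satisfying $z^m+f_1z^{m-1}+\dots+f_m=0$. Here a group $G$ is called $k$-solvable if there is a finite chain of subgroups $G=H_0\supseteq H_1\supseteq\dots\supseteq H_s=\{e\}$ such that each $H_{i+1}$ is normal in $H_i$ and each quotient $H_i/H_{i+1}$ is either abelian or isomorphic to a subgroup of the symmetric group $S_k$. -/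

import Mathlib

open Filter Topology

/-! ### Germs representable by radicals and by `k`-radicals -/

/-- `GermClass D a f` (with `a : ℂⁿ` and `f` a function defined near `a`): the germ of `f` at `a`
is obtained from germs of complex constants and of coordinate functions, in any number of
variables, by finitely many compositions, arithmetic operations, extractions of `m`-th roots and
solutions of monic algebraic equations of a degree `m ∈ D`, `m ≥ 1`.  All operations are applied
to single valued analytic germs: a quotient is formed only if the denominator does not vanish at
the point, and a root, or a solution of an algebraic equation, is any analytic germ satisfying
the corresponding identity. -/
inductive GermClass (D : Set ℕ) : {n : ℕ} → (Fin n → ℂ) → ((Fin n → ℂ) → ℂ) → Prop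
  | const {n : ℕ} (a : Fin n → ℂ) (c : ℂ) : GermClass D a (fun _ => c)
  | coord {n : ℕ} (a : Fin n → ℂ) (i : Fin n) : GermClass D a (fun x => x i)
  | congr {n : ℕ} {a : Fin n → ℂ} {f g : (Fin n → ℂ) → ℂ} :
      GermClass D a f → f =ᶠ[𝓝 a] g → GermClass D a g
  | add {n : ℕ} {a : Fin n → ℂ} {f g : (Fin n → ℂ) → ℂ} :
      GermClass D a f → GermClass D a g → GermClass D a (fun x => f x + g x)
  | sub {n : ℕ} {a : Fin n → ℂ} {f g : (Fin n → ℂ) → ℂ} :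
      GermClass D a f → GermClass D a g → GermClass D a (fun x => f x - g x)
  | mul {n : ℕ} {a : Fin n → ℂ} {f g : (Fin n → ℂ) → ℂ} :
      GermClass D a f → GermClass D a g → GermClass D a (fun x => f x * g x)
  | div {n : ℕ} {a : Fin n → ℂ} {f g : (Fin n → ℂ) → ℂ} :
      GermClass D a f → GermClass D a g → g a ≠ 0 → GermClass D a (fun x => f x / g x)
  | comp {k n : ℕ} {a : Fin n → ℂ} {f : (Fin k → ℂ) → ℂ} {g : Fin k → (Fin n → ℂ) → ℂ} :
      GermClass D (fun i => g i a) f → (∀ i, GermClass D a (g i)) →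
      GermClass D a (fun x => f (fun i => g i x))
  | root {n : ℕ} {a : Fin n → ℂ} {f g : (Fin n → ℂ) → ℂ} (m : ℕ) :
      2 ≤ m → GermClass D a f → AnalyticAt ℂ g a → (∀ᶠ x in 𝓝 a, g x ^ m = f x) →
      GermClass D a g
  | solve {n : ℕ} {a : Fin n → ℂ} (m : ℕ) {c : Fin m → (Fin n → ℂ) → ℂ}
      {y : (Fin n → ℂ) → ℂ} :
      1 ≤ m → m ∈ D → (∀ i, GermClass D a (c i)) → AnalyticAt ℂ y a →
      (∀ᶠ x in 𝓝 a, y x ^ m + ∑ i : Fin m, c i x * y x ^ (i : ℕ) = 0) →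
      GermClass D a y

/-- The germ of `f` at `a` is representable by radicals. -/
def RepresentableByRadicals {n : ℕ} (a : Fin n → ℂ) (f : (Fin n → ℂ) → ℂ) : Prop :=
  GermClass ∅ a f

/-- The germ of `f` at `a` is representable by `k`-radicals: solving algebraic equations of
degree at most `k` is allowed as well. -/
def RepresentableByKRadicals (k : ℕ) {n : ℕ} (a : Fin n → ℂ) (f : (Fin n → ℂ) → ℂ) : Prop :=
  GermClass {m | m ≤ k} a f

/-! ### `k`-solvable groups -/

/-- A group is `k`-solvable if it has a finite chain of subgroups
`G = H₀ ⊇ H₁ ⊇ … ⊇ Hₘ = 1`, each normal in the preceding one, such that every quotient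
`Hᵢ / Hᵢ₊₁` is abelian or isomorphic to a subgroup of the symmetric group `S_k`. -/
def IsKSolvable (k : ℕ) (G : Type*) [Group G] : Prop :=
  ∃ (m : ℕ) (H : ℕ → Subgroup G), H 0 = ⊤ ∧ H m = ⊥ ∧
    ∀ i < m, H (i + 1) ≤ H i ∧
      ∃ _ : ((H (i + 1)).subgroupOf (H i)).Normal,
        (∀ u v : H i ⧸ (H (i + 1)).subgroupOf (H i), u * v = v * u) ∨
        (∃ φ : (H i ⧸ (H (i + 1)).subgroupOf (H i)) →* Equiv.Perm (Fin k),
          Function.Injective φ)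

/-! ### The algebraic equation, its singular set and its solution germs -/

/-- The value `P(x, y)` of a polynomial in `y` with coefficients in `ℂ[x₁, …, x_N]`. -/
noncomputable def evalXY {N : ℕ} (P : Polynomial (MvPolynomial (Fin N) ℂ))
    (x : Fin N → ℂ) (y : ℂ) : ℂ :=
  (P.map (MvPolynomial.eval x)).eval y

/-- The singular set `Σ`: zeros of the product of the leading coefficient and the
discriminant of `P` (with respect to `y`). -/
def singularSet {N : ℕ} (P : Polynomial (MvPolynomial (Fin N) ℂ)) : Set (Fin N → ℂ) :=
  {x | MvPolynomial.eval x (P.leadingCoeff * P.discr) = 0}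

/-- `f` is analytic at `a` and satisfies `P(x, f(x)) = 0` near `a`. -/
def IsSolutionAt {N : ℕ} (P : Polynomial (MvPolynomial (Fin N) ℂ)) (a : Fin N → ℂ)
    (f : (Fin N → ℂ) → ℂ) : Prop :=
  AnalyticAt ℂ f a ∧ ∀ᶠ x in 𝓝 a, evalXY P x (f x) = 0

/-- The set of all germs at `a` of analytic solutions of the equation `P = 0`. -/
def SolutionGerm {N : ℕ} (P : Polynomial (MvPolynomial (Fin N) ℂ)) (a : Fin N → ℂ) : Type :=
  {g : (𝓝 a).Germ ℂ // ∃ f : (Fin N → ℂ) → ℂ, IsSolutionAt P a f ∧ (f : (𝓝 a).Germ ℂ) = g}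

/-! ### Analytic continuation and the monodromy group -/

/-- The germ `h` at `b` is the result of the analytic continuation of the germ `g` at `a` along
the path `γ`: there are analytic germs `F t` at the points `γ t` such that, locally in `t`, they
are germs of one and the same function, and which begin with `g` and end with `h`. -/
def ContinuesAlong {N : ℕ} {a b : Fin N → ℂ} (γ : Path a b)
    (g : (𝓝 a).Germ ℂ) (h : (𝓝 b).Germ ℂ) : Prop :=
  ∃ F : unitInterval → (Fin N → ℂ) → ℂ,
    (∀ t, AnalyticAt ℂ (F t) (γ t)) ∧
    (∀ t, ∀ᶠ s in 𝓝 t, F s =ᶠ[𝓝 (γ s)] F t) ∧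
    (F 0 : (𝓝 a).Germ ℂ) = g ∧ (F 1 : (𝓝 b).Germ ℂ) = h

theorem ContinuesAlong.refl {N : ℕ} {a : Fin N → ℂ} {f : (Fin N → ℂ) → ℂ}
    (hf : AnalyticAt ℂ f a) :
    ContinuesAlong (Path.refl a) (f : (𝓝 a).Germ ℂ) (f : (𝓝 a).Germ ℂ) :=
  ⟨fun _ => f, fun _ => hf, fun _ => Eventually.of_forall fun _ => EventuallyEq.rfl, rfl, rfl⟩

theorem ContinuesAlong.symm {N : ℕ} {a b : Fin N → ℂ} {γ : Path a b}
    {g : (𝓝 a).Germ ℂ} {h : (𝓝 b).Germ ℂ} (H : ContinuesAlong γ g h) :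
    ContinuesAlong γ.symm h g := by
  obtain ⟨F, hF, hl, h0, h1⟩ := H
  refine ⟨fun t => F (unitInterval.symm t), fun t => hF (unitInterval.symm t), fun t => ?_, by simpa using h1, by simpa using h0⟩
  exact (unitInterval.continuous_symm.tendsto t).eventually (hl (unitInterval.symm t))

theorem ContinuesAlong.trans {N : ℕ} {a b c : Fin N → ℂ} {γ : Path a b} {δ : Path b c}
    {g : (𝓝 a).Germ ℂ} {h : (𝓝 b).Germ ℂ} {k : (𝓝 c).Germ ℂ}
    (H : ContinuesAlong γ g h) (K : ContinuesAlong δ h k) :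
    ContinuesAlong (γ.trans δ) g k := by
  obtain ⟨F, hF, hFl, hF0, hF1⟩ := H
  obtain ⟨G, hG, hGl, hG0, hG1⟩ := K
  let p : unitInterval → unitInterval := fun t => Set.projIcc 0 1 zero_le_one (2 * (t : ℝ))
  let q : unitInterval → unitInterval := fun t => Set.projIcc 0 1 zero_le_one (2 * (t : ℝ) - 1)
  have hp : Continuous p := continuous_projIcc.comp (by fun_prop)
  have hq : Continuous q := continuous_projIcc.comp (by fun_prop)
  have hγ : ∀ t : unitInterval, (γ.trans δ) t = if (t : ℝ) ≤ 1 / 2 then γ (p t) else δ (q t) := by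
    intro t
    rw [Path.trans_apply]
    split_ifs with ht
    · congr 1
      exact (Set.projIcc_of_mem zero_le_one _).symm
    · congr 1
      exact (Set.projIcc_of_mem zero_le_one _).symm
  have hpq : ∀ t : unitInterval, (t : ℝ) = 1 / 2 → p t = 1 ∧ q t = 0 := by
    intro t ht
    simp only [p, q, ht]
    norm_num
  have hb : G 0 =ᶠ[𝓝 b] F 1 := by
    rw [← Filter.Germ.coe_eq, hG0, hF1]
  refine ⟨fun t => if (t : ℝ) ≤ 1 / 2 then F (p t) else G (q t), fun t => ?_, fun t => ?_, ?_, ?_⟩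
  · rw [hγ]
    dsimp only
    split_ifs
    · exact hF _
    · exact hG _
  · have hP : ∀ᶠ s in 𝓝 t, F (p s) =ᶠ[𝓝 (γ (p s))] F (p t) := (hp.tendsto t).eventually (hFl (p t))
    have hQ : ∀ᶠ s in 𝓝 t, G (q s) =ᶠ[𝓝 (δ (q s))] G (q t) := (hq.tendsto t).eventually (hGl (q t))
    rcases lt_trichotomy (t : ℝ) (1 / 2) with ht | ht | ht
    · have : ∀ᶠ s : unitInterval in 𝓝 t, (s : ℝ) < 1 / 2 :=
        (continuous_subtype_val.tendsto t).eventually (eventually_lt_nhds ht)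
      filter_upwards [hP, this] with s hs hs'
      rw [hγ]
      simpa only [if_pos hs'.le, if_pos ht.le] using hs
    · have hb' : ∀ᶠ s in 𝓝 t, G 0 =ᶠ[𝓝 (δ (q s))] F 1 := by
        have hcont : Tendsto (fun s => δ (q s)) (𝓝 t) (𝓝 b) := by
          have := (δ.continuous.comp hq).tendsto t
          simpa [Function.comp_def, (hpq t ht).2] using this
        exact hcont.eventually hb.eventuallyEq_nhds
      filter_upwards [hP, hQ, hb'] with s hs1 hs2 hs3
      rw [hγ]
      simp only [if_pos ht.le]
      rw [(hpq t ht).1] at hs1 ⊢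
      rw [(hpq t ht).2] at hs2
      split_ifs with hs
      · exact hs1
      · exact hs2.trans hs3
    · have : ∀ᶠ s : unitInterval in 𝓝 t, 1 / 2 < (s : ℝ) :=
        (continuous_subtype_val.tendsto t).eventually (eventually_gt_nhds ht)
      filter_upwards [hQ, this] with s hs hs'
      rw [hγ]
      simpa only [if_neg hs'.not_ge, if_neg ht.not_ge] using hs
  · have : p 0 = 0 := by simp [p]
    simpa [this] using hF0
  · have : q 1 = 1 := by simp only [q]; norm_num
    have h2 : ¬ (((1 : unitInterval) : ℝ) ≤ 1 / 2) := by norm_num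
    simpa only [if_neg h2, this] using hG1

/-- The monodromy group of the equation `P = 0` with base point `b`: the group of permutations
of the set of solution germs at `b` that are produced by the analytic continuation along loops
which begin and end at `b` and avoid the singular set. -/
def monodromyGroup {N : ℕ} (P : Polynomial (MvPolynomial (Fin N) ℂ)) (b : Fin N → ℂ)
    (hb : b ∉ singularSet P) : Subgroup (Equiv.Perm (SolutionGerm P b)) where
  carrier := {τ | ∃ γ : Path b b, (∀ t, γ t ∉ singularSet P) ∧
    ∀ g : SolutionGerm P b, ContinuesAlong γ g.1 (τ g).1}
  one_mem' := by
    refine ⟨Path.refl b, fun _ => hb, ?_⟩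
    rintro ⟨g, f, hf, rfl⟩
    exact ContinuesAlong.refl hf.1
  mul_mem' := by
    rintro τ ρ ⟨γ, hγ, hτ⟩ ⟨δ, hδ, hρ⟩
    refine ⟨δ.trans γ, fun t => ?_, fun g => (hρ g).trans (hτ (ρ g))⟩
    rw [Path.trans_apply]
    split_ifs
    · exact hδ _
    · exact hγ _
  inv_mem' := by
    rintro τ ⟨γ, hγ, hτ⟩
    refine ⟨γ.symm, fun t => hγ _, fun g => ?_⟩
    have := (hτ (τ⁻¹ g)).symm
    simpa using this

/-! Attach a formal variable to every solution germ at `b` and let the monodromy group permute the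
variables. Transporting the germs to `x₀` and substituting them turns polynomials in these variables
into germs at `x₀`. The polynomials with representable value form a subalgebra `C`, closed under the
extraction of roots and, for `k`-radicals, under solving monic equations of degree at most `k`. It
has to contain the variable that becomes `y`.

Analysis puts the invariants into `C`. An invariant polynomial in the solutions takes the same value
along all paths, so it is a single valued analytic function off the singular set. After
multiplication by a power of the leading coefficient it grows polynomially, since the roots do.
Multiplied further by the square of the equation of the singular set, it is entire on every complex
line, hence a polynomial by Liouville's argument. This is `germClass_of_monodromy_invariant`.

Algebra then descends along the chain of subgroups, from the invariants of `H i` to those of `H (i +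
1)`: by Lagrange resolvents for an abelian quotient (`mem_of_commutator_le`), by orbit polynomials
of degree at most `k` for a quotient inside `S_k` (`mem_of_ker_perm`). At the trivial subgroup every
polynomial is in `C`. -/

/-! ### Invariants of a finite group acting on an algebra -/

section GroupAction

open scoped commutatorElement

variable {Γ B : Type*} [Group Γ] [CommRing B] [Algebra ℂ B] [MulSemiringAction Γ B]

/-- Lagrange resolvents: if `h` has finite order and normalizes `K`, every `K`-invariant element
is a sum of elements some power of which is invariant under `K` and `h`. -/
theorem mem_of_normalizing_element [SMulCommClass Γ ℂ B] (C : Subalgebra ℂ B)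
    (hroot : ∀ (m : ℕ) (v : B), 2 ≤ m → v ^ m ∈ C → v ∈ C)
    (K : Subgroup Γ) (h : Γ) (hfin : IsOfFinOrder h) (hnorm : ∀ x ∈ K, h⁻¹ * x * h ∈ K)
    (hC : ∀ v : B, (∀ x ∈ K, x • v = v) → h • v = v → v ∈ C)
    (v : B) (hv : ∀ x ∈ K, x • v = v) : v ∈ C := by
  set m := orderOf h with hm
  have hmpos : 0 < m := hfin.orderOf_pos
  obtain ⟨ζ, hζ⟩ : ∃ ζ : ℂ, IsPrimitiveRoot ζ m :=
    ⟨_, Complex.isPrimitiveRoot_exp m hmpos.ne'⟩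
  -- The Lagrange resolvents of `v`.
  let r : ℕ → B := fun j => ∑ i ∈ Finset.range m, (ζ ^ j) ^ i • (h ^ i • v)
  have hpow : ∀ i : ℕ, ∀ x ∈ K, x • (h ^ i • v) = h ^ i • v := by
    intro i
    induction i with
    | zero => simpa using hv
    | succ i ih =>
      intro x hx
      have h1 := ih _ (hnorm x hx)
      have h2 : x • h • (h ^ i • v) = h • ((h⁻¹ * x * h) • (h ^ i • v)) := by
        simp only [smul_smul]; congr 1; group
      rw [pow_succ', mul_smul, h2, h1]
  have hrK : ∀ j, ∀ x ∈ K, x • r j = r j := by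
    intro j x hx
    simp only [r, Finset.smul_sum]
    refine Finset.sum_congr rfl fun i _ => ?_
    rw [smul_comm, hpow i x hx]
  -- The operation shifts the summation index by one; the last term wraps around because `h ^ m = 1`
  -- and `ζ ^ m = 1`.
  have hrh : ∀ j, ζ ^ j • (h • r j) = r j := by
    intro j
    have h1 : ζ ^ j • (h • r j) =
        ∑ i ∈ Finset.range m, (ζ ^ j) ^ (i + 1) • (h ^ (i + 1) • v) := by
      simp only [r, Finset.smul_sum]
      refine Finset.sum_congr rfl fun i _ => ?_
      rw [smul_comm h, smul_smul, smul_smul, ← pow_succ', ← pow_succ']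
    have h2 := Finset.sum_range_succ (fun i => (ζ ^ j) ^ i • (h ^ i • v)) m
    rw [Finset.sum_range_succ'] at h2
    have h3 : (ζ ^ j) ^ m = 1 := by rw [← pow_mul, mul_comm, pow_mul, hζ.pow_eq_one, one_pow]
    rw [h3, hm, pow_orderOf_eq_one, pow_zero, pow_zero] at h2
    rw [h1]
    exact add_right_cancel h2
  have hrC : ∀ j, r j ∈ C := by
    intro j
    -- The power `r j ^ m` is already invariant; the exponent is doubled because `m` may be 1 and
    -- roots are taken of order at least 2.
    refine hroot (2 * m) _ (by omega) ?_
    rw [mul_comm, pow_mul]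
    refine pow_mem (hC _ (fun x hx => by rw [smul_pow', hrK j x hx]) ?_) 2
    have h3 : (ζ ^ j) ^ m = 1 := by rw [← pow_mul, mul_comm, pow_mul, hζ.pow_eq_one, one_pow]
    calc h • r j ^ m = (h • r j) ^ m := by rw [smul_pow']
      _ = (ζ ^ j • (h • r j)) ^ m := by rw [smul_pow (ζ ^ j) (h • r j) m, h3, one_smul]
      _ = r j ^ m := by rw [hrh]
  -- Summing over `j` kills every power of `h` but the zeroth, as the powers of `ζ ^ i ≠ 1` sum to
  -- zero.
  have hsum : ∑ j ∈ Finset.range m, r j = (m : ℂ) • v := by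
    simp only [r]
    rw [Finset.sum_comm, Finset.sum_eq_single_of_mem 0 (Finset.mem_range.2 hmpos)]
    · simp [Nat.cast_smul_eq_nsmul]
    · intro i hi hi0
      rw [← Finset.sum_smul]
      have h1 : ζ ^ i ≠ 1 := hζ.pow_ne_one_of_pos_of_lt hi0 (Finset.mem_range.1 hi)
      have h2 : ∑ j ∈ Finset.range m, (ζ ^ j) ^ i = 0 := by
        have h3 : ∀ j, (ζ ^ j) ^ i = (ζ ^ i) ^ j := fun j => by rw [← pow_mul, ← pow_mul, mul_comm]
        simp only [h3]
        rw [geom_sum_eq h1, ← pow_mul, mul_comm, pow_mul, hζ.pow_eq_one]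
        simp
      rw [h2, zero_smul]
  have h4 : v = (m : ℂ)⁻¹ • ∑ j ∈ Finset.range m, r j := by
    rw [hsum, smul_smul, inv_mul_cancel₀ (by exact_mod_cast hmpos.ne'), one_smul]
  rw [h4]
  exact C.smul_mem (sum_mem fun j _ => hrC j) _

/-- If `H' ≤ H` contains the commutators of `H`, the `H'`-invariants are obtained from the
`H`-invariants by extracting roots. -/
theorem mem_of_commutator_le [SMulCommClass Γ ℂ B] [Finite Γ] (C : Subalgebra ℂ B)
    (hroot : ∀ (m : ℕ) (v : B), 2 ≤ m → v ^ m ∈ C → v ∈ C)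
    (H' H : Subgroup Γ) (hle : H' ≤ H) (hcomm : ⁅H, H⁆ ≤ H')
    (hC : ∀ v : B, (∀ x ∈ H, x • v = v) → v ∈ C) :
    ∀ v : B, (∀ x ∈ H', x • v = v) → v ∈ C := by
  suffices ∀ K : Subgroup Γ, H' ≤ K → K ≤ H → ∀ v : B, (∀ x ∈ K, x • v = v) → v ∈ C from
    this H' le_rfl hle
  intro K
  -- Descending from `H`: adjoin to `K` one element `h` of `H`. It normalizes `K`, because `K`
  -- contains the commutators of `H`.
  induction K using WellFoundedGT.induction with
  | ind K ih =>
    intro hK' hK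
    by_cases hKH : K = H
    · rwa [hKH]
    obtain ⟨h, hhH, hhK⟩ := SetLike.exists_of_lt (lt_of_le_of_ne hK hKH)
    have hlt : K < K ⊔ Subgroup.zpowers h :=
      lt_of_le_of_ne le_sup_left fun he => hhK (he ▸ Subgroup.mem_sup_right (Subgroup.mem_zpowers h))
    have hKC := ih _ hlt (hK'.trans le_sup_left)
      (sup_le hK ((Subgroup.zpowers_le).2 hhH))
    refine mem_of_normalizing_element C hroot K h (isOfFinOrder_of_finite h) (fun x hx => ?_) ?_
    · have h1 : ⁅h⁻¹, x⁆ ∈ K :=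
        hK' (hcomm (Subgroup.commutator_mem_commutator (H.inv_mem hhH) (hK hx)))
      have h2 : h⁻¹ * x * h = ⁅h⁻¹, x⁆ * x := by rw [commutatorElement_def]; group
      rw [h2]
      exact K.mul_mem h1 hx
    · intro v hvK hvh
      refine hKC v fun x hx => ?_
      have h1 : K ⊔ Subgroup.zpowers h ≤ MulAction.stabilizer Γ v :=
        sup_le (fun y hy => hvK y hy) ((Subgroup.zpowers_le).2 hvh)
      exact h1 hx

/-- An element whose stabilizer in `H` has index at most `k` is a root of a monic polynomial
of degree at most `k` with `H`-invariant coefficients. -/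
theorem mem_of_ncard_orbit_le [Finite Γ] (C : Subalgebra ℂ B) (k : ℕ)
    (hsolve : ∀ (m : ℕ) (c : Fin m → B) (v : B), 1 ≤ m → m ≤ k → (∀ i, c i ∈ C) →
      v ^ m + ∑ i : Fin m, c i * v ^ (i : ℕ) = 0 → v ∈ C)
    (H : Subgroup Γ) (hC : ∀ v : B, (∀ x ∈ H, x • v = v) → v ∈ C)
    (v : B) (hv : Nat.card (MulAction.orbit H v) ≤ k) : v ∈ C := by
  classical
  rcases subsingleton_or_nontrivial B with hB | hB
  · rw [Subsingleton.elim v 0]; exact C.zero_mem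
  have : Fintype H := Fintype.ofFinite H
  have hdeg : (prodXSubSMul H B v).natDegree = Nat.card (MulAction.orbit H v) := by
    rw [prodXSubSMul, Polynomial.natDegree_prod_of_monic _ _ fun _ _ => Polynomial.monic_X_sub_C _]
    simp only [Polynomial.natDegree_X_sub_C, Finset.sum_const, Finset.card_univ, smul_eq_mul,
      mul_one]
    rw [Nat.card_congr (MulAction.orbitEquivQuotientStabilizer H v), Nat.card_eq_fintype_card]
  have hpos : 0 < Nat.card (MulAction.orbit H v) :=
    Nat.card_pos_iff.2 ⟨⟨⟨v, MulAction.mem_orbit_self v⟩⟩, Set.finite_range fun x : H => x • v⟩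
  have hmonic := prodXSubSMul.monic H B v
  have heval := prodXSubSMul.eval H B v
  set p := prodXSubSMul H B v with hp
  refine hsolve p.natDegree (fun i => p.coeff i) v (by omega) (by omega) (fun i => ?_) ?_
  · exact hC _ fun x hx => prodXSubSMul.coeff H B v ⟨x, hx⟩ i
  · rw [Polynomial.eval_eq_sum_range, Finset.sum_range_succ, hmonic.coeff_natDegree, one_mul,
      ← Fin.sum_univ_eq_sum_range (fun i => p.coeff i * v ^ i)] at heval
    rw [add_comm]; exact heval

/-- If `H' ≤ H` is the kernel of a homomorphism from `H` to the symmetric group `S_k`, the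
`H'`-invariants are obtained from the `H`-invariants by solving equations of degree at most
`k`. -/
theorem mem_of_ker_perm [Finite Γ] (C : Subalgebra ℂ B) (k : ℕ)
    (hsolve : ∀ (m : ℕ) (c : Fin m → B) (v : B), 1 ≤ m → m ≤ k → (∀ i, c i ∈ C) →
      v ^ m + ∑ i : Fin m, c i * v ^ (i : ℕ) = 0 → v ∈ C)
    (H' H : Subgroup Γ) (ψ : H →* Equiv.Perm (Fin k)) (hψ : ∀ x : H, ψ x = 1 → (x : Γ) ∈ H')
    (hC : ∀ v : B, (∀ x ∈ H, x • v = v) → v ∈ C) :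
    ∀ v : B, (∀ x ∈ H', x • v = v) → v ∈ C := by
  -- Descent through the pointwise stabilizers of the first `j` points; for `j = k` this is the
  -- kernel of `ψ`.
  suffices ∀ j : ℕ, ∀ v : B,
      (∀ x : H, (∀ i : Fin k, (i : ℕ) < j → ψ x i = i) → (x : Γ) • v = v) → v ∈ C by
    intro v hv
    refine this k v fun x hx => hv _ (hψ x ?_)
    ext i
    rw [hx i i.2]; rfl
  intro j
  induction j with
  | zero => exact fun v hv => hC v fun x hx => hv ⟨x, hx⟩ (by simp)
  | succ j ih =>
    intro v hv
    by_cases hj : j < k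
    · let K : Subgroup Γ :=
        { carrier := {x | ∃ hx : x ∈ H, ∀ i : Fin k, (i : ℕ) < j → ψ ⟨x, hx⟩ i = i}
          one_mem' := ⟨H.one_mem, fun i _ => by
            have : (⟨1, H.one_mem⟩ : H) = 1 := rfl
            rw [this, map_one]; rfl⟩
          mul_mem' := by
            rintro x y ⟨hx, hx'⟩ ⟨hy, hy'⟩
            refine ⟨H.mul_mem hx hy, fun i hi => ?_⟩
            have : (⟨x * y, H.mul_mem hx hy⟩ : H) = ⟨x, hx⟩ * ⟨y, hy⟩ := rfl
            rw [this, map_mul, Equiv.Perm.mul_apply, hy' i hi, hx' i hi]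
          inv_mem' := by
            rintro x ⟨hx, hx'⟩
            refine ⟨H.inv_mem hx, fun i hi => ?_⟩
            have : (⟨x⁻¹, H.inv_mem hx⟩ : H) = ⟨x, hx⟩⁻¹ := rfl
            rw [this, map_inv, Equiv.Perm.inv_eq_iff_eq, hx' i hi] }
      refine mem_of_ncard_orbit_le C k hsolve K (fun w hw => ih w fun x hx => hw _ ⟨x.2, hx⟩) v ?_
      -- An element of the orbit is determined by the image of the point `j`, since `v` is fixed by
      -- the elements that fix this point as well. So the orbit has at most `k` elements.
      have key : ∀ w : MulAction.orbit K v, ∃ i : Fin k, ∃ x : K, x • v = w ∧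
          ψ ⟨x, x.2.1⟩ ⟨j, hj⟩ = i := by
        rintro ⟨w, x, rfl⟩
        exact ⟨_, x, rfl, rfl⟩
      choose F X hX hF using key
      have hinj : Function.Injective F := by
        intro w w' hww
        have h1 : (((X w')⁻¹ * X w : K) : Γ) • v = v := by
          refine hv ⟨_, ((X w')⁻¹ * X w).2.1⟩ fun i hi => ?_
          rcases Nat.lt_succ_iff_lt_or_eq.1 hi with hi | hi
          · exact ((X w')⁻¹ * X w).2.2 i hi
          · have h2 : (⟨_, ((X w')⁻¹ * X w).2.1⟩ : H) = ⟨X w', (X w').2.1⟩⁻¹ * ⟨X w, (X w).2.1⟩ :=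
              rfl
            have h3 : i = ⟨j, hj⟩ := Fin.ext hi
            rw [h2, map_mul, map_inv, Equiv.Perm.mul_apply, Equiv.Perm.inv_eq_iff_eq, h3, hF, hF,
              hww]
        refine Subtype.ext ?_
        rw [← hX w, ← hX w']
        have h2 : ((X w')⁻¹ * X w) • v = v := h1
        rw [mul_smul, inv_smul_eq_iff] at h2
        exact h2
      have := Nat.card_le_card_of_injective F hinj
      simpa using this
    · exact ih v fun x hx => hv x fun i _ => hx i (by omega)

theorem mem_of_isSolvable [SMulCommClass Γ ℂ B] [Finite Γ] [Group.IsSolvable Γ]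
    (C : Subalgebra ℂ B)
    (hroot : ∀ (m : ℕ) (v : B), 2 ≤ m → v ^ m ∈ C → v ∈ C)
    (hC : ∀ v : B, (∀ x : Γ, x • v = v) → v ∈ C) (v : B) : v ∈ C := by
  have key : ∀ n : ℕ, ∀ v : B, (∀ x ∈ derivedSeries Γ n, x • v = v) → v ∈ C := by
    intro n
    induction n with
    | zero => exact fun v hv => hC v fun x => hv x (by simp)
    | succ n ih =>
      exact mem_of_commutator_le C hroot _ (derivedSeries Γ n)
        (derivedSeries_antitone Γ n.le_succ) le_rfl ih
  obtain ⟨n, hn⟩ := Group.IsSolvable.solvable (G := Γ)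
  refine key n v fun x hx => ?_
  rw [hn, Subgroup.mem_bot] at hx
  rw [hx, one_smul]

theorem mem_of_isKSolvable [SMulCommClass Γ ℂ B] [Finite Γ] (C : Subalgebra ℂ B)
    (k : ℕ) (hΓ : IsKSolvable k Γ)
    (hroot : ∀ (m : ℕ) (v : B), 2 ≤ m → v ^ m ∈ C → v ∈ C)
    (hsolve : ∀ (m : ℕ) (c : Fin m → B) (v : B), 1 ≤ m → m ≤ k → (∀ i, c i ∈ C) →
      v ^ m + ∑ i : Fin m, c i * v ^ (i : ℕ) = 0 → v ∈ C)
    (hC : ∀ v : B, (∀ x : Γ, x • v = v) → v ∈ C) (v : B) : v ∈ C := by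
  obtain ⟨n, H, h0, hn, hH⟩ := hΓ
  have key : ∀ i ≤ n, ∀ v : B, (∀ x ∈ H i, x • v = v) → v ∈ C := by
    intro i
    induction i with
    | zero => exact fun _ v hv => hC v fun x => hv x (by simp [h0])
    | succ i ih =>
      intro hi
      have ih := ih (by omega)
      obtain ⟨hle, hN, hab | ⟨φ, hφ⟩⟩ := hH i (by omega)
      · refine mem_of_commutator_le C hroot _ (H i) hle ?_ ih
        rw [Subgroup.commutator_le]
        intro a ha c hc
        have h1 := hab (QuotientGroup.mk ⟨a, ha⟩) (QuotientGroup.mk ⟨c, hc⟩)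
        rw [← QuotientGroup.mk_mul, ← QuotientGroup.mk_mul, eq_comm, QuotientGroup.eq,
          Subgroup.mem_subgroupOf] at h1
        -- Conjugating `(c * a)⁻¹ * (a * c)` by `c * a` gives the commutator of `a` and `c`.
        have h2 := (hN.conj_mem _ (Subgroup.mem_subgroupOf.2 h1) (⟨c, hc⟩ * ⟨a, ha⟩))
        rw [Subgroup.mem_subgroupOf] at h2
        convert h2 using 1
        simp [commutatorElement_def, mul_assoc]
      · refine mem_of_ker_perm C k hsolve _ (H i)
          (φ.comp (QuotientGroup.mk' ((H (i + 1)).subgroupOf (H i)))) (fun x hx => ?_) ih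
        have h1 : (QuotientGroup.mk' ((H (i + 1)).subgroupOf (H i))) x = 1 :=
          hφ (by rw [map_one]; exact hx)
        rw [QuotientGroup.mk'_apply, QuotientGroup.eq_one_iff, Subgroup.mem_subgroupOf] at h1
        exact h1
  refine key n le_rfl v fun x hx => ?_
  rw [hn, Subgroup.mem_bot] at hx
  rw [hx, one_smul]

end GroupAction

/-! ### Roots of the equation near a nonsingular point -/

section Specialization

variable {N : ℕ} {P : Polynomial (MvPolynomial (Fin N) ℂ)} {a : Fin N → ℂ}

theorem eval_leadingCoeff_ne_zero (ha : a ∉ singularSet P) :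
    MvPolynomial.eval a P.leadingCoeff ≠ 0 := fun h => ha (by simp [singularSet, h])

theorem natDegree_map_eval (ha : a ∉ singularSet P) :
    (P.map (MvPolynomial.eval a)).natDegree = P.natDegree :=
  Polynomial.natDegree_map_of_leadingCoeff_ne_zero _ (eval_leadingCoeff_ne_zero ha)

theorem map_eval_ne_zero (ha : a ∉ singularSet P) : P.map (MvPolynomial.eval a) ≠ 0 := fun h => by
  have h1 : (P.map (MvPolynomial.eval a)).coeff P.natDegree = 0 := by rw [h]; simp
  rw [Polynomial.coeff_map] at h1
  exact eval_leadingCoeff_ne_zero ha h1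

/-- The resultant of `P` and its derivative is, up to sign, the leading coefficient times the
discriminant, and it is a combination of the two polynomials. A common root at `a` would make it
vanish there. -/
theorem derivative_eval_ne_zero (ha : a ∉ singularSet P) {r : ℂ} (hr : evalXY P a r = 0) :
    (P.map (MvPolynomial.eval a)).derivative.eval r ≠ 0 := by
  intro hr'
  have hr : (P.map (MvPolynomial.eval a)).eval r = 0 := hr
  have hpos : 0 < P.natDegree := by
    rw [← natDegree_map_eval ha]
    by_contra h0
    rw [not_lt, Nat.le_zero] at h0
    have hne := map_eval_ne_zero ha
    rw [Polynomial.eq_C_of_natDegree_eq_zero h0] at hr hne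
    rw [Polynomial.eval_C] at hr
    exact hne (by rw [hr, Polynomial.C_0])
  have h1 := congrArg (MvPolynomial.eval a)
    (Polynomial.resultant_deriv (Polynomial.natDegree_pos_iff_degree_pos.1 hpos))
  rw [← Polynomial.resultant_map_map, ← Polynomial.derivative_map] at h1
  obtain ⟨p, q, -, -, hpq⟩ := Polynomial.exists_mul_add_mul_eq_C_resultant
    (m := P.natDegree) (n := P.natDegree - 1) (P.map (MvPolynomial.eval a))
    (P.map (MvPolynomial.eval a)).derivative (natDegree_map_eval ha).le
    ((Polynomial.natDegree_derivative_le _).trans (by rw [natDegree_map_eval ha]))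
    (Or.inl hpos.ne')
  rw [h1] at hpq
  have h2 := congrArg (Polynomial.eval r) hpq
  simp only [Polynomial.eval_add, Polynomial.eval_mul, hr, hr', zero_mul, add_zero,
    Polynomial.eval_C, map_mul, map_pow, map_neg, map_one] at h2
  refine ha ?_
  simp only [singularSet, Set.mem_ofPred_eq, map_mul]
  rw [eq_comm, mul_assoc, mul_eq_zero] at h2
  exact h2.resolve_left (by simp)

theorem card_roots_map_eval (ha : a ∉ singularSet P) :
    (P.map (MvPolynomial.eval a)).roots.toFinset.card = P.natDegree := by
  have hsep : (P.map (MvPolynomial.eval a)).roots.Nodup := by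
    classical
    rw [Multiset.nodup_iff_count_le_one]
    intro r
    rw [Polynomial.count_roots]
    by_contra! h
    have h1 := (Polynomial.one_lt_rootMultiplicity_iff_isRoot (map_eval_ne_zero ha)).1 h
    exact derivative_eval_ne_zero ha h1.1 h1.2
  rw [Multiset.toFinset_card_of_nodup hsep, ← natDegree_map_eval ha]
  exact (IsAlgClosed.splits _).natDegree_eq_card_roots.symm

theorem contDiff_mvPolynomial_eval (p : MvPolynomial (Fin N) ℂ) {n : WithTop ℕ∞} :
    ContDiff ℂ n fun x : Fin N → ℂ => MvPolynomial.eval x p := by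
  induction p using MvPolynomial.induction_on with
  | C c => simpa using contDiff_const
  | add p q hp hq => simpa using hp.add hq
  | mul_X p i hp => simpa using hp.mul (contDiff_apply ℂ ℂ i)

theorem evalXY_eq_sum (x : Fin N → ℂ) (y : ℂ) :
    evalXY P x y = ∑ i ∈ Finset.range (P.natDegree + 1),
      MvPolynomial.eval x (P.coeff i) * y ^ i := by
  rw [evalXY, Polynomial.eval_map, Polynomial.eval₂_eq_sum_range]

theorem contDiff_evalXY {n : WithTop ℕ∞} :
    ContDiff ℂ n fun u : (Fin N → ℂ) × ℂ => evalXY P u.1 u.2 := by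
  simp only [evalXY_eq_sum]
  exact ContDiff.sum fun i _ =>
    ((contDiff_mvPolynomial_eval _).comp contDiff_fst).mul (contDiff_snd.pow i)

theorem isClosed_singularSet : IsClosed (singularSet P) :=
  isClosed_eq (contDiff_mvPolynomial_eval (n := 0) _).continuous continuous_const

theorem exists_analyticAt_of_root (ha : a ∉ singularSet P) {r : ℂ} (hr : evalXY P a r = 0) :
    ∃ f : (Fin N → ℂ) → ℂ, AnalyticAt ℂ f a ∧ f a = r ∧ ∀ᶠ x in 𝓝 a, evalXY P x (f x) = 0 := by
  let Φ : (Fin N → ℂ) × ℂ → ℂ := fun u => evalXY P u.1 u.2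
  have hΦ : ContDiffAt ℂ ⊤ Φ (a, r) := contDiff_evalXY.contDiffAt
  have hinv : (fderiv ℂ Φ (a, r) ∘L .inr ℂ (Fin N → ℂ) ℂ).IsInvertible := by
    have h1 : HasFDerivAt Φ (fderiv ℂ Φ (a, r)) (a, r) :=
      (hΦ.differentiableAt (by simp)).hasFDerivAt
    have h2 : HasFDerivAt (fun y : ℂ => (a, y)) (.inr ℂ (Fin N → ℂ) ℂ) r :=
      hasFDerivAt_prodMk_right a r
    have h3 := (h1.comp r h2).hasDerivAt
    have h4 : HasDerivAt (fun y : ℂ => evalXY P a y)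
      ((P.map (MvPolynomial.eval a)).derivative.eval r) r := Polynomial.hasDerivAt _ _
    have h5 := h3.unique h4
    refine ⟨ContinuousLinearEquiv.unitsEquivAut ℂ (Units.mk0 _ (derivative_eval_ne_zero ha hr)), ?_⟩
    ext
    rw [h5]
    simp
  refine ⟨hΦ.implicitFunction (by simp) hinv, ?_, hΦ.implicitFunction_apply_self _ _, ?_⟩
  · have := hΦ.contDiffAt_implicitFunction (by simp) hinv
    exact this.analyticAt
  · have := hΦ.eventually_apply_implicitFunction (by simp) hinv
    filter_upwards [this] with x hx
    exact hx.trans hr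

/-- Near a nonsingular point the roots are given by finitely many analytic functions with pairwise
distinct values. -/
theorem exists_local_branches (ha : a ∉ singularSet P) :
    ∃ (ε : ℝ) (f : (P.map (MvPolynomial.eval a)).roots.toFinset → (Fin N → ℂ) → ℂ), 0 < ε ∧
      ∀ x ∈ Metric.ball a ε, x ∉ singularSet P ∧ (∀ r, AnalyticAt ℂ (f r) x) ∧
        (∀ r r', f r x = f r' x → r = r') ∧ (∀ y, evalXY P x y = 0 ↔ ∃ r, f r x = y) := by
  classical
  set R := (P.map (MvPolynomial.eval a)).roots.toFinset with hR
  have hroot : ∀ r : R, evalXY P a r = 0 := fun r =>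
    (Polynomial.mem_roots (map_eval_ne_zero ha)).1 (Multiset.mem_toFinset.1 r.2)
  choose f hfa hfr hf0 using fun r : R => exists_analyticAt_of_root ha (hroot r)
  have h1 : ∀ᶠ x in 𝓝 a, x ∉ singularSet P := isClosed_singularSet.isOpen_compl.mem_nhds ha
  have h2 : ∀ᶠ x in 𝓝 a, ∀ r, AnalyticAt ℂ (f r) x :=
    eventually_all.2 fun r => (hfa r).eventually_analyticAt
  have h3 : ∀ᶠ x in 𝓝 a, ∀ r r', f r x = f r' x → r = r' := by
    refine eventually_all.2 fun r => eventually_all.2 fun r' => ?_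
    by_cases hrr : r = r'
    · exact Eventually.of_forall fun _ _ => hrr
    · have : f r a ≠ f r' a := by rw [hfr, hfr]; exact fun h => hrr (Subtype.ext h)
      filter_upwards [(hfa r).continuousAt.ne_iff_eventually_ne (hfa r').continuousAt |>.1 this]
        with x hx h using absurd h hx
  have h4 : ∀ᶠ x in 𝓝 a, ∀ r, evalXY P x (f r x) = 0 := eventually_all.2 hf0
  obtain ⟨ε, hε, hball⟩ := Metric.eventually_nhds_iff_ball.1 (h1.and (h2.and (h3.and h4)))
  refine ⟨ε, f, hε, fun x hx => ?_⟩
  obtain ⟨hx1, hx2, hx3, hx4⟩ := hball x hx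
  refine ⟨hx1, hx2, hx3, fun y => ⟨fun hy => ?_, ?_⟩⟩
  -- The branches give as many distinct roots at `x` as the degree allows, so they exhaust the
  -- roots.
  · have himg : Finset.univ.image (fun r => f r x) =
        (P.map (MvPolynomial.eval x)).roots.toFinset := by
      refine Finset.eq_of_subset_of_card_le ?_ ?_
      · intro w hw
        obtain ⟨r, -, rfl⟩ := Finset.mem_image.1 hw
        rw [Multiset.mem_toFinset, Polynomial.mem_roots (map_eval_ne_zero hx1)]
        exact hx4 r
      · rw [Finset.card_image_of_injective _ fun r r' h => hx3 r r' h, Finset.card_univ,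
          Fintype.card_coe, card_roots_map_eval hx1, hR, card_roots_map_eval ha]
    have : y ∈ (P.map (MvPolynomial.eval x)).roots.toFinset := by
      rw [Multiset.mem_toFinset, Polynomial.mem_roots (map_eval_ne_zero hx1)]
      exact hy
    rw [← himg] at this
    obtain ⟨r, -, hr⟩ := Finset.mem_image.1 this
    exact ⟨r, hr⟩
  · rintro ⟨r, rfl⟩
    exact hx4 r

end Specialization

/-! ### Analytic continuation off the singular set -/

section Transport

variable {N : ℕ} {P : Polynomial (MvPolynomial (Fin N) ℂ)}

/-- The bijections between the solution germs at `a` and at `a'` produced by the analytic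
continuation along paths that avoid the singular set. -/
def Transport (P : Polynomial (MvPolynomial (Fin N) ℂ)) (a a' : Fin N → ℂ) :
    Set (SolutionGerm P a ≃ SolutionGerm P a') :=
  {T | ∃ γ : Path a a', (∀ t, γ t ∉ singularSet P) ∧ ∀ g, ContinuesAlong γ g.1 (T g).1}

theorem Transport.trans {a b c : Fin N → ℂ} {T : SolutionGerm P a ≃ SolutionGerm P b}
    {T' : SolutionGerm P b ≃ SolutionGerm P c} (hT : T ∈ Transport P a b)
    (hT' : T' ∈ Transport P b c) : T.trans T' ∈ Transport P a c := by
  obtain ⟨γ, hγ, h⟩ := hT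
  obtain ⟨δ, hδ, h'⟩ := hT'
  refine ⟨γ.trans δ, fun t => ?_, fun g => (h g).trans (h' (T g))⟩
  rw [Path.trans_apply]
  split_ifs
  · exact hγ _
  · exact hδ _

theorem Transport.symm {a b : Fin N → ℂ} {T : SolutionGerm P a ≃ SolutionGerm P b}
    (hT : T ∈ Transport P a b) : T.symm ∈ Transport P b a := by
  obtain ⟨γ, hγ, h⟩ := hT
  refine ⟨γ.symm, fun t => hγ _, fun g => ?_⟩
  have := (h (T.symm g)).symm
  simpa using this

theorem mem_monodromyGroup_of_transport {b : Fin N → ℂ} (hb : b ∉ singularSet P)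
    {T : SolutionGerm P b ≃ SolutionGerm P b} (hT : T ∈ Transport P b b) :
    T ∈ monodromyGroup P b hb := hT

/-- A solution germ at `x` takes the value of exactly one branch at `x`. By continuity it avoids the
other branches nearby, so it coincides with that one. The same branches serve all points of the
ball. -/
theorem exists_local_parametrization {a : Fin N → ℂ} (ha : a ∉ singularSet P) :
    ∃ (ε : ℝ) (R : Finset ℂ) (f : R → (Fin N → ℂ) → ℂ), 0 < ε ∧
      ∀ x ∈ Metric.ball a ε, x ∉ singularSet P ∧ (∀ r, AnalyticAt ℂ (f r) x) ∧
        ∃ e : R ≃ SolutionGerm P x, ∀ r, (e r).1 = (f r : (𝓝 x).Germ ℂ) := by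
  obtain ⟨ε, f, hε, hf⟩ := exists_local_branches ha
  refine ⟨ε, _, f, hε, fun x hx => ⟨(hf x hx).1, (hf x hx).2.1, ?_⟩⟩
  have hball : ∀ᶠ x' in 𝓝 x, x' ∈ Metric.ball a ε := Metric.isOpen_ball.mem_nhds hx
  have hsol : ∀ r, IsSolutionAt P x (f r) := fun r => ⟨(hf x hx).2.1 r, by
    filter_upwards [hball] with x' hx'
    exact ((hf x' hx').2.2.2 _).2 ⟨r, rfl⟩⟩
  refine ⟨Equiv.ofBijective (fun r => ⟨(f r : (𝓝 x).Germ ℂ), f r, hsol r, rfl⟩) ⟨?_, ?_⟩,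
    fun r => rfl⟩
  · intro r r' h
    have h1 : (f r : (𝓝 x).Germ ℂ) = f r' := congrArg Subtype.val h
    rw [Filter.Germ.coe_eq] at h1
    exact (hf x hx).2.2.1 r r' h1.eq_of_nhds
  · rintro ⟨g, y, hy, rfl⟩
    obtain ⟨r, hr⟩ := ((hf x hx).2.2.2 (y x)).1 hy.2.self_of_nhds
    refine ⟨r, Subtype.ext ?_⟩
    change (f r : (𝓝 x).Germ ℂ) = y
    rw [Filter.Germ.coe_eq]
    have h1 : ∀ᶠ x' in 𝓝 x, ∀ r', r' ≠ r → f r' x' ≠ y x' := by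
      refine eventually_all.2 fun r' => ?_
      by_cases hrr : r' = r
      · exact Eventually.of_forall fun _ h => absurd hrr h
      · have : f r' x ≠ y x := by
          rw [← hr]; exact fun h => hrr ((hf x hx).2.2.1 _ _ h)
        filter_upwards [(((hf x hx).2.1 r').continuousAt.ne_iff_eventually_ne
          hy.1.continuousAt).1 this] with x' hx' _ using hx'
    filter_upwards [h1, hball, hy.2] with x' h1' hx' hy'
    obtain ⟨r', hr'⟩ := ((hf x' hx').2.2.2 (y x')).1 hy'
    by_cases hrr : r' = r
    · rw [← hrr]; exact hr'
    · exact absurd hr' (h1' r' hrr)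

theorem finite_solutionGerm {a : Fin N → ℂ} (ha : a ∉ singularSet P) :
    Finite (SolutionGerm P a) := by
  obtain ⟨ε, R, f, hε, hf⟩ := exists_local_parametrization ha
  obtain ⟨-, -, e, -⟩ := hf a (Metric.mem_ball_self hε)
  exact Finite.of_equiv R e

theorem exists_local_transport {a : Fin N → ℂ} (ha : a ∉ singularSet P) :
    ∃ (F : SolutionGerm P a → (Fin N → ℂ) → ℂ), (∀ s, (F s : (𝓝 a).Germ ℂ) = s.1) ∧
      ∀ᶠ x in 𝓝 a, x ∉ singularSet P ∧ (∀ s, AnalyticAt ℂ (F s) x) ∧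
        ∃ T ∈ Transport P a x, ∀ s, (T s).1 = (F s : (𝓝 x).Germ ℂ) := by
  obtain ⟨ε, R, f, hε, hf⟩ := exists_local_parametrization ha
  have haε := Metric.mem_ball_self (x := a) hε
  obtain ⟨-, -, e, he⟩ := hf a haε
  refine ⟨fun s => f (e.symm s), fun s => ?_, ?_⟩
  · rw [← he, Equiv.apply_symm_apply]
  filter_upwards [Metric.ball_mem_nhds a hε] with x hx
  obtain ⟨hxs, hxa, e', he'⟩ := hf x hx
  refine ⟨hxs, fun s => hxa _, e.symm.trans e', ?_, fun s => he' _⟩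
  obtain ⟨γ, hγ⟩ := ((convex_ball a ε).isPathConnected ⟨a, haε⟩).joinedIn a haε x hx
  refine ⟨γ, fun t => (hf _ (hγ t)).1, fun s => ⟨fun _ => f (e.symm s),
    fun t => (hf _ (hγ t)).2.1 _, fun t => Eventually.of_forall fun _ => EventuallyEq.rfl,
    ?_, ?_⟩⟩
  · rw [← he, Equiv.apply_symm_apply]
  · exact (he' _).symm

/-- The restriction of a polynomial to a complex line. -/
theorem exists_polynomial_on_line (p : MvPolynomial (Fin N) ℂ) (a v : Fin N → ℂ) :
    ∃ q : Polynomial ℂ, ∀ z, q.eval z = MvPolynomial.eval (a + z • v) p := by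
  refine ⟨MvPolynomial.aeval (fun i => Polynomial.C (a i) + Polynomial.C (v i) * Polynomial.X) p,
    fun z => ?_⟩
  induction p using MvPolynomial.induction_on with
  | C c => simp
  | add p q hp hq => simp [hp, hq]
  | mul_X p i hp => simp [hp, mul_comm z]

/-- The complex line through two nonsingular points meets the singular set in finitely many points,
and the plane minus a finite set is connected. -/
theorem isPreconnected_compl_singularSet : IsPreconnected (singularSet P)ᶜ := by
  refine isPreconnected_of_forall_pair fun a ha b _ => ?_
  obtain ⟨q, hq⟩ := exists_polynomial_on_line (P.leadingCoeff * P.discr) a (b - a)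
  have hq0 : q ≠ 0 := by
    rintro rfl
    refine ha ?_
    have := hq 0
    simp only [Polynomial.eval_zero, zero_smul, add_zero] at this
    exact this.symm
  have hc : (q.rootSet ℂ)ᶜ = {z | a + z • (b - a) ∈ (singularSet P)ᶜ} := by
    ext z
    simp only [Set.mem_compl_iff, Polynomial.mem_rootSet, hq0, ne_eq, not_false_eq_true, true_and,
      Polynomial.coe_aeval_eq_eval, hq, Set.mem_ofPred_eq, singularSet]
  have hconn : IsPreconnected (q.rootSet ℂ)ᶜ :=
    ((q.rootSet_finite ℂ).countable.isConnected_compl_of_one_lt_rank (by simp)).isPreconnected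
  refine ⟨(fun z : ℂ => a + z • (b - a)) '' (q.rootSet ℂ)ᶜ, ?_, ⟨0, ?_, by simp⟩,
    ⟨1, ?_, by simp⟩, hconn.image _ (by fun_prop)⟩
  · rintro _ ⟨z, hz, rfl⟩
    rw [hc] at hz
    exact hz
  · rw [hc]; simpa using ha
  · rw [hc]; simpa

/-- Being joined by a transport is symmetric and transitive and holds for nearby points, hence holds
throughout a connected set. -/
theorem exists_transport {a b : Fin N → ℂ} (ha : a ∉ singularSet P) (hb : b ∉ singularSet P) :
    ∃ T, T ∈ Transport P a b := by
  refine isPreconnected_compl_singularSet.induction₂ (fun a b => ∃ T, T ∈ Transport P a b)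
    (fun x hx => ?_) ?_ ?_ ha hb
  · obtain ⟨F, -, hF⟩ := exists_local_transport hx
    filter_upwards [nhdsWithin_le_nhds hF] with y hy
    obtain ⟨T, hT, -⟩ := hy.2.2
    exact ⟨T, hT⟩
  · rintro x y z - - - ⟨T, hT⟩ ⟨T', hT'⟩
    exact ⟨_, Transport.trans hT hT'⟩
  · rintro x y - - ⟨T, hT⟩
    exact ⟨_, Transport.symm hT⟩

end Transport

/-! ### Polynomial growth -/

section Growth

variable {E : Type*} [NormedAddCommGroup E] {U : Set E}

/-- The function `φ` is bounded on `U` by a polynomial in the norm. -/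
def PolyGrowth (U : Set E) (φ : E → ℝ) : Prop :=
  ∃ (C : ℝ) (D : ℕ), 0 ≤ C ∧ ∀ x ∈ U, φ x ≤ C * (1 + ‖x‖) ^ D

theorem PolyGrowth.mono {φ ψ : E → ℝ} (h : PolyGrowth U ψ) (hle : ∀ x ∈ U, φ x ≤ ψ x) :
    PolyGrowth U φ := by
  obtain ⟨C, D, hC, h⟩ := h
  exact ⟨C, D, hC, fun x hx => (hle x hx).trans (h x hx)⟩

theorem PolyGrowth.const (c : ℝ) : PolyGrowth U fun _ => c :=
  ⟨|c|, 0, abs_nonneg c, fun _ _ => by simpa using le_abs_self c⟩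

theorem PolyGrowth.add {φ ψ : E → ℝ} (h : PolyGrowth U φ) (h' : PolyGrowth U ψ) :
    PolyGrowth U fun x => φ x + ψ x := by
  obtain ⟨C, D, hC, h⟩ := h
  obtain ⟨C', D', hC', h'⟩ := h'
  refine ⟨C + C', D + D', by positivity, fun x hx => ?_⟩
  have h1 : (1 : ℝ) ≤ 1 + ‖x‖ := by linarith [norm_nonneg x]
  have h2 : (1 + ‖x‖) ^ D ≤ (1 + ‖x‖) ^ (D + D') := pow_le_pow_right₀ h1 (by omega)
  have h3 : (1 + ‖x‖) ^ D' ≤ (1 + ‖x‖) ^ (D + D') := pow_le_pow_right₀ h1 (by omega)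
  rw [add_mul]
  exact add_le_add ((h x hx).trans (mul_le_mul_of_nonneg_left h2 hC))
    ((h' x hx).trans (mul_le_mul_of_nonneg_left h3 hC'))

theorem PolyGrowth.mul {φ ψ : E → ℝ} (h : PolyGrowth U φ) (h' : PolyGrowth U ψ)
    (hψ : ∀ x, 0 ≤ ψ x) : PolyGrowth U fun x => φ x * ψ x := by
  obtain ⟨C, D, hC, h⟩ := h
  obtain ⟨C', D', hC', h'⟩ := h'
  refine ⟨C * C', D + D', by positivity, fun x hx => ?_⟩
  have := mul_le_mul (h x hx) (h' x hx) (hψ x) (by positivity)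
  calc φ x * ψ x ≤ _ := this
    _ = _ := by rw [pow_add]; ring

theorem PolyGrowth.sum {ι : Type*} (s : Finset ι) {φ : ι → E → ℝ}
    (h : ∀ i, PolyGrowth U (φ i)) : PolyGrowth U fun x => ∑ i ∈ s, φ i x := by
  classical
  induction s using Finset.induction_on with
  | empty => simpa using PolyGrowth.const 0
  | insert i s hi ih => simpa [Finset.sum_insert hi] using (h i).add ih

theorem polyGrowth_mvPolynomial_eval {N : ℕ} {U : Set (Fin N → ℂ)}
    (p : MvPolynomial (Fin N) ℂ) : PolyGrowth U fun x => ‖MvPolynomial.eval x p‖ := by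
  induction p using MvPolynomial.induction_on with
  | C c => simpa using PolyGrowth.const ‖c‖
  | add p q hp hq => exact (hp.add hq).mono fun x _ => by simpa using norm_add_le _ _
  | mul_X p i hp =>
    have h1 : PolyGrowth U fun x => ‖x‖ := ⟨1, 1, zero_le_one, fun x _ => by simp⟩
    refine (hp.mul h1 fun x => norm_nonneg x).mono fun x _ => ?_
    simp only [map_mul, MvPolynomial.eval_X, norm_mul]
    exact mul_le_mul_of_nonneg_left (norm_le_pi_norm x i) (norm_nonneg _)

end Growth

/-! ### Polynomials are representable -/

section Radicals

variable {N : ℕ} {a : Fin N → ℂ} {D : Set ℕ}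

theorem GermClass.sum {ι : Type*} (s : Finset ι) {f : ι → (Fin N → ℂ) → ℂ}
    (h : ∀ i, GermClass D a (f i)) : GermClass D a fun x => ∑ i ∈ s, f i x := by
  classical
  induction s using Finset.induction_on with
  | empty => simpa using GermClass.const a 0
  | insert i s hi ih => simpa [Finset.sum_insert hi] using (h i).add ih

theorem GermClass.prod {ι : Type*} (s : Finset ι) {f : ι → (Fin N → ℂ) → ℂ}
    (h : ∀ i, GermClass D a (f i)) : GermClass D a fun x => ∏ i ∈ s, f i x := by
  classical
  induction s using Finset.induction_on with
  | empty => simpa using GermClass.const a 1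
  | insert i s hi ih => simpa [Finset.prod_insert hi] using (h i).mul ih

theorem GermClass.mvPolynomial_eval (p : MvPolynomial (Fin N) ℂ) :
    GermClass D a fun x => MvPolynomial.eval x p := by
  induction p using MvPolynomial.induction_on with
  | C c => simpa using GermClass.const a c
  | add p q hp hq => simpa using hp.add hq
  | mul_X p i hp => simpa using hp.mul (GermClass.coord a i)

/-- Used for the terms of a Taylor series at `a`. -/
theorem GermClass.multilinear {m : ℕ} (p : MultilinearMap ℂ (fun _ : Fin m => Fin N → ℂ) ℂ) :
    GermClass D a fun x => p fun _ => x - a := by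
  classical
  have h : ∀ x : Fin N → ℂ, p (fun _ => x - a) =
      ∑ r : Fin m → Fin N, (∏ i, (x (r i) - a (r i))) * p fun i => Pi.single (r i) 1 := by
    intro x
    have h1 : x - a = ∑ j, (x j - a j) • (Pi.single j 1 : Fin N → ℂ) := by
      ext i
      simp [Finset.sum_apply, Pi.single_apply]
    calc p (fun _ => x - a)
        = p (fun _ => ∑ j, (x j - a j) • (Pi.single j 1 : Fin N → ℂ)) := by rw [← h1]
      _ = _ := by
        rw [MultilinearMap.map_sum]
        refine Finset.sum_congr rfl fun r _ => ?_
        rw [MultilinearMap.map_smul_univ, smul_eq_mul]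
  simp only [h]
  exact GermClass.sum _ fun r => (GermClass.prod _ fun i =>
    (GermClass.coord a _).sub (GermClass.const a _)).mul (GermClass.const a _)

end Radicals

/-! ### Liouville's theorem and removal of the hypersurface -/

section Liouville

variable {N : ℕ} {a : Fin N → ℂ} {D : Set ℕ}

theorem iteratedDeriv_eq_zero_of_polyGrowth {f : ℂ → ℂ} (hf : Differentiable ℂ f) {C : ℝ} {d m : ℕ}
    (hC : 0 ≤ C) (h : ∀ z, ‖f z‖ ≤ C * (1 + ‖z‖) ^ d) (hm : d < m) : iteratedDeriv m f 0 = 0 := by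
  rw [← norm_le_zero_iff]
  -- Cauchy's estimate on the circle of radius `R`; the bound tends to zero as `R` grows.
  have key : ∀ R : ℝ, 1 ≤ R → ‖iteratedDeriv m f 0‖ ≤ m.factorial * (C * 2 ^ d) / R := by
    intro R hR
    have h0 : 0 < R := by linarith
    refine (Complex.norm_iteratedDeriv_le_of_forall_mem_sphere_norm_le (C := C * (1 + R) ^ d) m h0
      hf.diffContOnCl fun z hz => ?_).trans ?_
    · have := h z
      rwa [mem_sphere_zero_iff_norm.1 hz] at this
    · rw [div_le_div_iff₀ (by positivity) h0]
      have h1 : (1 + R) ^ d ≤ 2 ^ d * R ^ d := by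
        rw [← mul_pow]; exact pow_le_pow_left₀ (by positivity) (by linarith) _
      have h2 : R ^ d * R ≤ R ^ m := by
        rw [← pow_succ]; exact pow_le_pow_right₀ hR hm
      calc m.factorial * (C * (1 + R) ^ d) * R ≤ m.factorial * (C * (2 ^ d * R ^ d)) * R := by gcongr
        _ = m.factorial * (C * 2 ^ d) * (R ^ d * R) := by ring
        _ ≤ _ := by gcongr
  exact ge_of_tendsto (tendsto_const_nhds.div_atTop tendsto_id) ((eventually_ge_atTop 1).mono key)

/-- A function that is entire of polynomial growth on all complex lines through `a` is a polynomial
near `a`. -/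
theorem germClass_of_entire_on_lines {k : (Fin N → ℂ) → ℂ} (hk : AnalyticAt ℂ k a)
    (hline : ∀ v : Fin N → ℂ, Differentiable ℂ fun z : ℂ => k (a + z • v))
    (hgrowth : PolyGrowth Set.univ fun x => ‖k x‖) : GermClass D a k := by
  obtain ⟨C, d, hC, hbound⟩ := hgrowth
  obtain ⟨p, r, hp⟩ := hk
  have hp0 : HasFPowerSeriesOnBall (fun w => k (a + w)) p 0 r :=
    ⟨hp.r_le, hp.r_pos, fun {y} hy => by simpa using hp.hasSum hy⟩
  -- Up to `m !`, the degree `m` term at `v` is the `m`-th derivative of the restriction to the line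
  -- in direction `v`.
  have hzero : ∀ m, d < m → ∀ v, p m (fun _ => v) = 0 := by
    intro m hm v
    let u : ℂ →L[ℂ] (Fin N → ℂ) := ContinuousLinearMap.toSpanSingleton ℂ v
    have h1 : HasFPowerSeriesOnBall (fun w => k (a + w)) p (u 0) r := by simpa using hp0
    have h2 := h1.compContinuousLinearMap.factorial_smul 1 m
    have h3 : iteratedDeriv m (fun z : ℂ => k (a + z • v)) 0 = 0 := by
      refine iteratedDeriv_eq_zero_of_polyGrowth (hline v)
        (C := C * (1 + ‖a‖ + ‖v‖) ^ d) (d := d) (by positivity) (fun z => ?_) hm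
      refine (hbound _ (Set.mem_univ _)).trans ?_
      rw [mul_assoc, ← mul_pow]
      have h4 : ‖a + z • v‖ ≤ ‖a‖ + ‖z‖ * ‖v‖ := (norm_add_le _ _).trans (by rw [norm_smul])
      have h5 : 1 + ‖a + z • v‖ ≤ (1 + ‖a‖ + ‖v‖) * (1 + ‖z‖) := by
        nlinarith [norm_nonneg a, norm_nonneg v, norm_nonneg z,
          mul_nonneg (norm_nonneg a) (norm_nonneg z)]
      gcongr
    have h6 : ((fun w => k (a + w)) ∘ u) = fun z : ℂ => k (a + z • v) := by
      ext z; simp [u]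
    rw [h6, ← iteratedDeriv_eq_iteratedFDeriv, h3] at h2
    have h7 : (p.compContinuousLinearMap u) m (fun _ => (1 : ℂ)) = p m fun _ => v := by
      rw [FormalMultilinearSeries.compContinuousLinearMap_apply]
      congr 1
      ext i
      simp [u]
    rw [h7] at h2
    exact (smul_eq_zero.1 h2).resolve_left (Nat.factorial_ne_zero m)
  have hsum : GermClass D a fun x => ∑ m ∈ Finset.range (d + 1), p m fun _ => x - a :=
    GermClass.sum _ fun m => GermClass.multilinear (p m).toMultilinearMap
  refine hsum.congr ?_
  have hball : ∀ᶠ x in 𝓝 a, x ∈ Metric.eball a r := Metric.eball_mem_nhds a hp.r_pos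
  filter_upwards [hball] with x hx
  have h1 := hp.hasSum_sub hx
  have h2 := hasSum_sum_of_ne_finset_zero (L := SummationFilter.unconditional ℕ) (f := fun m => p m fun _ => x - a)
    (s := Finset.range (d + 1)) fun m hm => hzero m (by simpa using hm) _
  exact h2.unique h1

/-- A function that is analytic and of polynomial growth off the hypersurface `Q = 0` is
representable at every point of the complement. -/
theorem germClass_of_analytic_off_hypersurface {m : (Fin N → ℂ) → ℂ} (Q : MvPolynomial (Fin N) ℂ)
    (hm : ∀ x, MvPolynomial.eval x Q ≠ 0 → AnalyticAt ℂ m x)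
    (hgrowth : PolyGrowth {x | MvPolynomial.eval x Q ≠ 0} fun x => ‖m x‖)
    (ha : MvPolynomial.eval a Q ≠ 0) : GermClass D a m := by
  obtain ⟨C, d, hC, hbound⟩ := hgrowth
  have hQan : ∀ x, AnalyticAt ℂ (fun x => MvPolynomial.eval x Q) x := fun x =>
    (contDiff_mvPolynomial_eval Q (n := ⊤)).contDiffAt.analyticAt
  -- The square makes `k` vanish to second order along every line at a zero of `Q`, up to the growth
  -- factor. So `k` has derivative zero there, whatever the values of `m` on the hypersurface.
  let k : (Fin N → ℂ) → ℂ := fun x => m x * MvPolynomial.eval x Q ^ 2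
  have hkan : ∀ x, MvPolynomial.eval x Q ≠ 0 → AnalyticAt ℂ k x := fun x hx =>
    (hm x hx).mul ((hQan x).pow 2)
  have hkbound : ∀ x, ‖k x‖ ≤ C * (1 + ‖x‖) ^ d * ‖MvPolynomial.eval x Q‖ ^ 2 := by
    intro x
    by_cases hx : MvPolynomial.eval x Q = 0
    · simp [k, hx]
    · simp only [k, norm_mul, norm_pow]
      gcongr
      exact hbound x hx
  have hk : GermClass D a k := by
    refine germClass_of_entire_on_lines (hkan a ha) (fun v z => ?_) ?_
    · by_cases hz : MvPolynomial.eval (a + z • v) Q = 0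
      · refine HasDerivAt.differentiableAt (f' := 0) ?_
        rw [hasDerivAt_iff_isLittleO]
        have hk0 : k (a + z • v) = 0 := by simp [k, hz]
        simp only [hk0, smul_zero, sub_zero]
        let q : ℂ → ℂ := fun w => MvPolynomial.eval (a + w • v) Q
        have hq : DifferentiableAt ℂ q z := by
          have h1 : DifferentiableAt ℂ (fun x => MvPolynomial.eval x Q) (a + z • v) :=
            (hQan _).differentiableAt
          exact DifferentiableAt.comp (g := fun x => MvPolynomial.eval x Q) z h1 (by fun_prop)
        have hq0 : q z = 0 := hz
        have h1 : q =O[𝓝 z] fun w => w - z := by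
          simpa [hq0] using hq.isBigO_sub
        have h2 : q =o[𝓝 z] fun _ => (1 : ℝ) := by
          rw [Asymptotics.isLittleO_one_iff, ← hq0]
          exact hq.continuousAt
        have h3 : (fun w => k (a + w • v)) =O[𝓝 z] fun w => q w * q w := by
          have h4 : (fun w : ℂ => C * (1 + ‖a + w • v‖) ^ d) =O[𝓝 z] fun _ => (1 : ℝ) := by
            have : Continuous fun w : ℂ => C * (1 + ‖a + w • v‖) ^ d := by fun_prop
            exact (this.tendsto z).isBigO_one ℝ
          have h5 : (fun w => k (a + w • v)) =O[𝓝 z]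
              fun w => C * (1 + ‖a + w • v‖) ^ d * ‖q w * q w‖ := by
            refine Asymptotics.IsBigO.of_bound' (Eventually.of_forall fun w => ?_)
            refine (hkbound _).trans (le_of_eq ?_)
            rw [Real.norm_of_nonneg (by positivity), norm_mul, sq]
          have h6 := h5.trans (h4.mul (Asymptotics.isBigO_refl (fun w => ‖q w * q w‖) (𝓝 z)))
          rw [← Asymptotics.isBigO_norm_right]
          simpa using h6
        refine h3.trans_isLittleO ?_
        have h7 := h2.mul_isBigO h1.norm_right
        simpa using h7.norm_right
      · have h1 : DifferentiableAt ℂ k (a + z • v) := (hkan _ hz).differentiableAt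
        exact DifferentiableAt.comp (g := k) (f := fun z : ℂ => a + z • v) z h1 (by fun_prop)
    · have h1 : PolyGrowth Set.univ fun x : Fin N → ℂ => C * (1 + ‖x‖) ^ d :=
        ⟨C, d, hC, fun x _ => le_rfl⟩
      refine (h1.mul ((polyGrowth_mvPolynomial_eval Q).mul (polyGrowth_mvPolynomial_eval Q) fun x => norm_nonneg _) fun x => by positivity).mono
        fun x _ => (hkbound x).trans (le_of_eq (by rw [sq]))
  have hQ : GermClass D a fun x => MvPolynomial.eval x (Q ^ 2) := GermClass.mvPolynomial_eval _
  refine (hk.div hQ (by simpa using ha)).congr ?_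
  filter_upwards [(hQan a).continuousAt.eventually_ne ha] with x hx
  simp only [k, map_pow]
  field_simp

end Liouville

/-! ### Monodromy invariants are representable -/

section Monodromy

variable {N : ℕ} {P : Polynomial (MvPolynomial (Fin N) ℂ)} {D : Set ℕ}

/-- Cauchy's bound for the roots, with the maximum of the coefficients replaced by their sum. -/
theorem norm_leadingCoeff_mul_root_le {x : Fin N → ℂ} (hx : x ∉ singularSet P) {w : ℂ}
    (hw : evalXY P x w = 0) : ‖MvPolynomial.eval x P.leadingCoeff‖ * ‖w‖ ≤
      ∑ i ∈ Finset.range (P.natDegree + 1), ‖MvPolynomial.eval x (P.coeff i)‖ := by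
  have h1 := (Polynomial.IsRoot.norm_lt_cauchyBound (map_eval_ne_zero hx)
    (show (P.map (MvPolynomial.eval x)).IsRoot w from hw)).le
  rw [Polynomial.cauchyBound, natDegree_map_eval hx,
    Polynomial.leadingCoeff_map_of_leadingCoeff_ne_zero _ (eval_leadingCoeff_ne_zero hx)] at h1
  simp only [Polynomial.coeff_map] at h1
  have h2 : (Finset.range P.natDegree).sup (fun i => ‖MvPolynomial.eval x (P.coeff i)‖₊) ≤
      ∑ i ∈ Finset.range P.natDegree, ‖MvPolynomial.eval x (P.coeff i)‖₊ :=
    Finset.sup_le fun i hi => Finset.single_le_sum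
      (f := fun i => ‖MvPolynomial.eval x (P.coeff i)‖₊) (fun _ _ => zero_le) hi
  have h0 : ‖MvPolynomial.eval x P.leadingCoeff‖₊ ≠ 0 :=
    nnnorm_ne_zero_iff.2 (eval_leadingCoeff_ne_zero hx)
  have h3 : ‖MvPolynomial.eval x P.leadingCoeff‖₊ * ‖w‖₊ ≤
      ∑ i ∈ Finset.range (P.natDegree + 1), ‖MvPolynomial.eval x (P.coeff i)‖₊ := by
    calc ‖MvPolynomial.eval x P.leadingCoeff‖₊ * ‖w‖₊
        ≤ ‖MvPolynomial.eval x P.leadingCoeff‖₊ *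
          ((Finset.range P.natDegree).sup (fun i => ‖MvPolynomial.eval x (P.coeff i)‖₊) /
            ‖MvPolynomial.eval x P.leadingCoeff‖₊ + 1) := by gcongr
      _ = (Finset.range P.natDegree).sup (fun i => ‖MvPolynomial.eval x (P.coeff i)‖₊) +
          ‖MvPolynomial.eval x P.leadingCoeff‖₊ := by
        rw [mul_add, mul_div_cancel₀ _ h0, mul_one]
      _ ≤ _ := by
        rw [Finset.sum_range_succ]
        gcongr
        exact le_rfl
  simpa using NNReal.coe_le_coe.2 h3

/-- Polynomials in the roots of `P`, multiplied by a power of the leading coefficient, have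
polynomial growth. -/
theorem exists_polyGrowth_eval_roots {S : Type*} {w : (Fin N → ℂ) → S → ℂ}
    (hw : ∀ x ∉ singularSet P, ∀ s, evalXY P x (w x s) = 0) (q : MvPolynomial S ℂ) :
    ∃ d : ℕ, PolyGrowth (singularSet P)ᶜ fun x =>
      ‖MvPolynomial.eval x P.leadingCoeff ^ d * MvPolynomial.eval (w x) q‖ := by
  induction q using MvPolynomial.induction_on with
  | C c => exact ⟨0, by simpa using PolyGrowth.const ‖c‖⟩
  | add p q hp hq =>
    obtain ⟨d, hd⟩ := hp
    obtain ⟨e, he⟩ := hq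
    have hl := fun n : ℕ => polyGrowth_mvPolynomial_eval (U := (singularSet P)ᶜ) (P.leadingCoeff ^ n)
    refine ⟨d + e, ((hd.mul (hl e) fun x => norm_nonneg _).add
      (he.mul (hl d) fun x => norm_nonneg _)).mono fun x _ => ?_⟩
    rw [← norm_mul, ← norm_mul]
    refine le_trans (le_of_eq ?_) (norm_add_le _ _)
    congr 1
    simp only [map_add, map_pow]
    ring
  | mul_X p s hp =>
    obtain ⟨d, hd⟩ := hp
    have h1 : PolyGrowth (singularSet P)ᶜ fun x =>
        ∑ i ∈ Finset.range (P.natDegree + 1), ‖MvPolynomial.eval x (P.coeff i)‖ :=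
      PolyGrowth.sum _ fun i => polyGrowth_mvPolynomial_eval _
    refine ⟨d + 1, (hd.mul h1 fun x => by positivity).mono fun x hx => ?_⟩
    have h2 : MvPolynomial.eval x P.leadingCoeff ^ (d + 1) *
        MvPolynomial.eval (w x) (p * MvPolynomial.X s) =
        MvPolynomial.eval x P.leadingCoeff ^ d * MvPolynomial.eval (w x) p *
          (MvPolynomial.eval x P.leadingCoeff * w x s) := by
      simp only [map_mul, MvPolynomial.eval_X]
      ring
    rw [h2, norm_mul, norm_mul (MvPolynomial.eval x P.leadingCoeff)]
    exact mul_le_mul_of_nonneg_left (norm_leadingCoeff_mul_root_le hx (hw x hx s)) (norm_nonneg _)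

theorem evalXY_germ_value {x : Fin N → ℂ} (g : SolutionGerm P x) :
    evalXY P x g.1.value = 0 := by
  obtain ⟨g, y, hy, rfl⟩ := g
  exact hy.2.self_of_nhds

theorem analyticAt_eval_family {S : Type*} {x₀ : Fin N → ℂ} {f : S → (Fin N → ℂ) → ℂ}
    (hf : ∀ s, AnalyticAt ℂ (f s) x₀) (q : MvPolynomial S ℂ) :
    AnalyticAt ℂ (fun x => MvPolynomial.eval (fun s => f s x) q) x₀ := by
  induction q using MvPolynomial.induction_on with
  | C c => simpa using analyticAt_const
  | add p q hp hq => simpa using hp.fun_add hq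
  | mul_X p s hp => simpa using hp.fun_mul (hf s)

/-- A polynomial in the solution germs that is invariant under the monodromy group is representable
at all nonsingular points. -/
theorem germClass_of_monodromy_invariant {b : Fin N → ℂ} (hb : b ∉ singularSet P)
    {x₀ : Fin N → ℂ} (hx₀ : x₀ ∉ singularSet P) {T₀ : SolutionGerm P b ≃ SolutionGerm P x₀}
    (hT₀ : T₀ ∈ Transport P b x₀) {f : SolutionGerm P b → (Fin N → ℂ) → ℂ}
    (hf : ∀ s, (f s : (𝓝 x₀).Germ ℂ) = (T₀ s).1) (q : MvPolynomial (SolutionGerm P b) ℂ)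
    (hq : ∀ τ ∈ monodromyGroup P b hb, MvPolynomial.rename τ q = q) :
    GermClass D x₀ fun x => MvPolynomial.eval (fun s => f s x) q := by
  classical
  have := finite_solutionGerm hb
  -- The transports are chosen point by point with no continuity in `x`; the invariance of `q` makes
  -- the choice immaterial.
  choose T hT using fun x : {x // x ∉ singularSet P} => exists_transport hb x.2
  let w : (Fin N → ℂ) → SolutionGerm P b → ℂ := fun x s =>
    if hx : x ∉ singularSet P then (T ⟨x, hx⟩ s).1.value else 0
  have hw : ∀ x ∉ singularSet P, ∀ s, evalXY P x (w x s) = 0 := fun x hx s => by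
    simp only [w, hx, not_false_eq_true, dite_true]
    exact evalXY_germ_value _
  let c : (Fin N → ℂ) → ℂ := fun x => MvPolynomial.eval (w x) q
  have hc : ∀ x ∉ singularSet P, ∀ T' ∈ Transport P b x,
      -- Two transports from `b` to `x` differ by an element of the monodromy group.
      c x = MvPolynomial.eval (fun s => (T' s).1.value) q := by
    intro x hx T' hT'
    have h1 := hq _ (mem_monodromyGroup_of_transport hb
      (Transport.trans (hT ⟨x, hx⟩) (Transport.symm hT')))
    refine Eq.trans ?_ (congrArg (MvPolynomial.eval fun s => (T' s).1.value) h1)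
    rw [MvPolynomial.eval_rename]
    refine congrArg (fun v => MvPolynomial.eval v q) (funext fun s => ?_)
    simp [w, hx]
  have hlocal : ∀ x (hx : x ∉ singularSet P) (T' : SolutionGerm P b ≃ SolutionGerm P x),
      T' ∈ Transport P b x → ∃ F : SolutionGerm P b → (Fin N → ℂ) → ℂ,
      (∀ s, (F s : (𝓝 x).Germ ℂ) = (T' s).1) ∧ (∀ s, AnalyticAt ℂ (F s) x) ∧
      c =ᶠ[𝓝 x] fun x' => MvPolynomial.eval (fun s => F s x') q := by
    intro x hx T' hT'
    obtain ⟨F, hF, hloc⟩ := exists_local_transport hx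
    refine ⟨fun s => F (T' s), fun s => hF _, fun s => hloc.self_of_nhds.2.1 _, ?_⟩
    filter_upwards [hloc] with x' hloc'
    obtain ⟨hx', -, T'', hT'', hval⟩ := hloc'
    rw [hc x' hx' _ (Transport.trans hT' hT'')]
    refine congrArg (fun v => MvPolynomial.eval v q) (funext fun s => ?_)
    rw [Equiv.trans_apply, hval]
    rfl
  have hcan : ∀ x ∉ singularSet P, AnalyticAt ℂ c x := by
    intro x hx
    obtain ⟨F, -, hFa, hFc⟩ := hlocal x hx _ (hT ⟨x, hx⟩)
    exact (analyticAt_eval_family hFa q).congr hFc.symm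
  obtain ⟨d, hd⟩ := exists_polyGrowth_eval_roots hw q
  have hset : {x | MvPolynomial.eval x (P.leadingCoeff * P.discr) ≠ 0} = (singularSet P)ᶜ := rfl
  have hm : GermClass D x₀ fun x => MvPolynomial.eval x P.leadingCoeff ^ d * c x := by
    refine germClass_of_analytic_off_hypersurface (P.leadingCoeff * P.discr) (fun x hx => ?_)
      hd hx₀
    exact (((contDiff_mvPolynomial_eval _ (n := ⊤)).contDiffAt.analyticAt).fun_pow d).fun_mul
      (hcan x hx)
  have hl : GermClass D x₀ fun x => MvPolynomial.eval x (P.leadingCoeff ^ d) :=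
    GermClass.mvPolynomial_eval _
  refine (hm.div hl (by simpa using fun h => absurd h (eval_leadingCoeff_ne_zero hx₀))).congr ?_
  obtain ⟨F, hF, -, hFc⟩ := hlocal x₀ hx₀ T₀ hT₀
  have hFf : ∀ᶠ x in 𝓝 x₀, ∀ s, F s x = f s x := eventually_all.2 fun s => by
    have := (hF s).trans (hf s).symm
    rwa [Filter.Germ.coe_eq] at this
  filter_upwards [hFc, hFf, isClosed_singularSet.isOpen_compl.mem_nhds hx₀] with x h1 h2 h3
  have h4 := eval_leadingCoeff_ne_zero h3
  rw [h1]
  simp only [h2, map_pow]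
  field_simp

end Monodromy

/-! ### The subalgebra of representable polynomials and the theorem -/

section Main

/-- The action of a group of permutations of the variables on polynomials. -/
noncomputable abbrev permuteVariables {S : Type*} (G : Subgroup (Equiv.Perm S)) :
    MulSemiringAction G (MvPolynomial S ℂ) where
  smul τ p := MvPolynomial.rename τ.1 p
  one_smul p := MvPolynomial.rename_id_apply p
  mul_smul τ ρ p := (MvPolynomial.rename_rename ρ.1 τ.1 p).symm
  smul_zero _ := map_zero _
  smul_add _ := map_add _
  smul_one _ := map_one _
  smul_mul _ := map_mul _

variable {N : ℕ} {x₀ : Fin N → ℂ} {S : Type*}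

/-- The polynomials in a family of germs that are representable. -/
def representableSubalgebra (D : Set ℕ) (x₀ : Fin N → ℂ) (f : S → (Fin N → ℂ) → ℂ) :
    Subalgebra ℂ (MvPolynomial S ℂ) where
  carrier := {q | GermClass D x₀ fun x => MvPolynomial.eval (fun s => f s x) q}
  mul_mem' hp hq := by simpa using GermClass.mul hp hq
  add_mem' hp hq := by simpa using GermClass.add hp hq
  algebraMap_mem' c := by simpa [MvPolynomial.algebraMap_eq] using GermClass.const x₀ c

theorem mem_representableSubalgebra {D : Set ℕ} {f : S → (Fin N → ℂ) → ℂ}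
    {q : MvPolynomial S ℂ} : q ∈ representableSubalgebra D x₀ f ↔
      GermClass D x₀ fun x => MvPolynomial.eval (fun s => f s x) q := Iff.rfl

theorem mem_representableSubalgebra_of_pow {D : Set ℕ} {f : S → (Fin N → ℂ) → ℂ}
    (hf : ∀ s, AnalyticAt ℂ (f s) x₀) (m : ℕ) (v : MvPolynomial S ℂ) (hm : 2 ≤ m)
    (hv : v ^ m ∈ representableSubalgebra D x₀ f) : v ∈ representableSubalgebra D x₀ f :=
  GermClass.root m hm hv (analyticAt_eval_family hf v) (Eventually.of_forall fun x => by simp)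

theorem mem_representableSubalgebra_of_equation {D : Set ℕ} {f : S → (Fin N → ℂ) → ℂ}
    (hf : ∀ s, AnalyticAt ℂ (f s) x₀) (m : ℕ) (c : Fin m → MvPolynomial S ℂ)
    (v : MvPolynomial S ℂ) (hm : 1 ≤ m) (hmD : m ∈ D)
    (hc : ∀ i, c i ∈ representableSubalgebra D x₀ f)
    (hv : v ^ m + ∑ i : Fin m, c i * v ^ (i : ℕ) = 0) : v ∈ representableSubalgebra D x₀ f :=
  GermClass.solve m hm hmD hc (analyticAt_eval_family hf v) (Eventually.of_forall fun x => by
    simpa using congrArg (MvPolynomial.eval fun s => f s x) hv)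

end Main

theorem theorem7 (N : ℕ) (P : Polynomial (MvPolynomial (Fin N) ℂ))
    (hP : Irreducible
      (P.map (algebraMap (MvPolynomial (Fin N) ℂ) (FractionRing (MvPolynomial (Fin N) ℂ)))))
    (b : Fin N → ℂ) (hb : b ∉ singularSet P)
    (x₀ : Fin N → ℂ) (hx₀ : x₀ ∉ singularSet P)
    (y : (Fin N → ℂ) → ℂ) (hy : IsSolutionAt P x₀ y) :
    (Group.IsSolvable (monodromyGroup P b hb) → RepresentableByRadicals x₀ y) ∧
    (∀ k : ℕ, IsKSolvable k (monodromyGroup P b hb) → RepresentableByKRadicals k x₀ y) := by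
  obtain ⟨T, hT⟩ := exists_transport hb hx₀
  have := finite_solutionGerm hb
  choose f hf hfT using fun s : SolutionGerm P b => (T s).2
  -- The germ at `b` whose continuation to `x₀` is `y`.
  let s₀ : SolutionGerm P b := T.symm ⟨y, y, hy, rfl⟩
  have hs₀ : f s₀ =ᶠ[𝓝 x₀] y := by
    rw [← Filter.Germ.coe_eq, hfT]
    exact congrArg Subtype.val (T.apply_symm_apply _)
  let := permuteVariables (monodromyGroup P b hb)
  have : SMulCommClass (monodromyGroup P b hb) ℂ (MvPolynomial (SolutionGerm P b) ℂ) :=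
    ⟨fun τ c p => map_smul (MvPolynomial.rename τ.1) c p⟩
  have hinv : ∀ (D : Set ℕ) (q : MvPolynomial (SolutionGerm P b) ℂ),
      (∀ τ : monodromyGroup P b hb, τ • q = q) → q ∈ representableSubalgebra D x₀ f :=
    fun D q hq => germClass_of_monodromy_invariant hb hx₀ hT hfT q fun τ hτ => hq ⟨τ, hτ⟩
  have hroot := fun D : Set ℕ => mem_representableSubalgebra_of_pow (D := D) fun s => (hf s).1
  have hfinal : ∀ D : Set ℕ, MvPolynomial.X s₀ ∈ representableSubalgebra D x₀ f →
      GermClass D x₀ y := fun D h => by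
    rw [mem_representableSubalgebra] at h
    simp only [MvPolynomial.eval_X] at h
    exact h.congr hs₀
  refine ⟨fun hG => hfinal ∅ (mem_of_isSolvable _ (hroot ∅) (hinv ∅) _), fun k hG => ?_⟩
  exact hfinal _ (mem_of_isKSolvable _ k hG (hroot _)
    (fun m c v h1 hk => mem_representableSubalgebra_of_equation (fun s => (hf s).1) m c v h1 hk)
    (hinv _) _)
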